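/- **Model.** There are a finite set of students $\mathcal{I}$, a set of schools, a finite set of types $\mathcal{M}$ and a map $\tau:\mathcal{I}\to\mathcal{M}$; $\mathcal{I}^m=\tau^{-1}(m)$. Each school $s$ has $q_s$ seats and, for each $m\in\mathcal{M}$, a reserve quota $q_s^m\in\mathbb{N}\cup\{0\}$, where $\sum_{m} q_s^m<q_s$ and $q_s^m<|\mathcal{I}^m|$ for every $m$. Each school $s$ ranks the students strictly, by scores that are pairwise distinct. **SimFlex.** Fix a school $s$. It has two subschools, $s^o$ (open seats) and $s^r$ (reserved seats). For disjoint sets $J$ of applicants to $s^o$ and $J'$ of applicants to $s^r$, the choice rule $\mathcal{C}^{SimFlex}$ first assigns, for each $m$, reserved seats to the highest-ranked students in $J'\cap\mathcal{I}^m$, up to the quota $q_s^m$; then it assigns all remaining seats of $s$ as open seats to the highest-ranked students in $J$, until all seats are filled or all of $J$ is admitted. $\mathcal{C}^{SimFlex}(J,J')$ records the chosen students and their seat types. **The rule $\mathcal{C}^*$.** Let $I,I'$ be disjoint sets of students, where those in $I$ report $s^o$–$s^r$ (they rank $s^o$ immediately above $s^r$) and those in $I'$ report $s^r$–$s^o$.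 Run student-proposing deferred acceptance in the economy consisting of $s$ and the students in $I\cup I'$, with $s$ using $\mathcal{C}^{SimFlex}$: in each round, every unassigned student applies to the best subschool in her list that has not rejected her; if $J$ and $J'$ are the students standing at $s^o$ and at $s^r$ (new applicants together with those tentatively admitted in the previous round), the school tentatively admits according to $\mathcal{C}^{SimFlex}(J,J')$ and rejects the others from the subschool at which they stand; the procedure stops when there are no further rejections. The final assignment is $\mathcal{C}^*(I,I')$, and $\mathcal{C}^*\langle I,I'\rangle$ is the set of students chosen in it. **Proposition.** For every school $s$, every pair of disjoint sets of students $(I,I')$ and every $i\in I'$, $$\mathcal{C}^*\langle I,I'\rangle\cap\mathcal{I}^{\tau(i)}\subseteq \mathcal{C}^*\langle I\cup\{i\},\,I'\setminus\{i\}\rangle\cap\mathcal{I}^{\tau(i)}.$$ That is, if one student $i$ switches from reporting $s^r$–$s^o$ to reporting $s^o$–$s^r$ while all other reports stay the same, then every student of the same type as $i$ who was chosen before is still chosen. -/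

import Mathlib

/-- The two kinds of seats: open seats (subschool `s^o`) and reserved seats (subschool `s^r`). -/
inductive SeatType where
  | openSeat : SeatType
  | reservedSeat : SeatType
deriving DecidableEq

instance : Fintype SeatType where
  elems := {SeatType.openSeat, SeatType.reservedSeat}
  complete := by intro t; cases t <;> simp

/-- A school choice environment with reserve quotas (everything but the students' preferences). -/
structure SchoolChoice (Student School MType : Type*) [Fintype Student] [Fintype MType]
    [DecidableEq MType] where
  /-- the type `τ(i)` of student `i` -/
  type : Student → MType
  /-- the number `q_s` of seats of school `s` -/
  capacity : School → ℕ
  /-- the number `q_s^m` of seats which school `s` reserves for type `m` -/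
  reserve : School → MType → ℕ
  /-- the priority score of a student at a school; a higher score is a higher priority -/
  score : School → Student → ℕ
  /-- priorities are strict -/
  score_injective : ∀ s, Function.Injective (score s)
  /-- every school has at least one open seat -/
  sum_reserve_lt : ∀ s, ∑ m, reserve s m < capacity s
  /-- no type fits entirely into the seats reserved for it -/
  reserve_lt_card : ∀ s m, reserve s m < (Finset.univ.filter fun i => type i = m).card

namespace SchoolChoice

/-- The set of chosen students of a set of (student, seat type) assignments. -/
def chosen {Student : Type*} [DecidableEq Student] (μ : Finset (Student × SeatType)) :
    Finset Student :=
  μ.image Prod.fst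

section DeferredAcceptance

variable {Student : Type*} [Fintype Student] [DecidableEq Student]

/-- The students who stand at the subschool with seats of type `t` when the pairs in `R` are the
rejections so far. `pref i` is the list of acceptable subschools of `i`, best first. A student
stands at the best subschool that has not rejected her: she applies there if she was just rejected
elsewhere, and remains there as long as she is tentatively admitted. -/
def applicants (pref : Student → List SeatType) (R : Finset (Student × SeatType))
    (t : SeatType) : Finset Student :=
  Finset.univ.filter fun i => (pref i).find? (fun u => decide ((i, u) ∉ R)) = some t

/-- The school's (tentative) selection in the round that starts with the rejections `R`, when it
uses the choice rule `C`, a function of the applicants to `s^o` and the applicants to `s^r`. -/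
def selection (C : Finset Student → Finset Student → Finset (Student × SeatType))
    (pref : Student → List SeatType) (R : Finset (Student × SeatType)) :
    Finset (Student × SeatType) :=
  C (applicants pref R .openSeat) (applicants pref R .reservedSeat)

/-- One round of deferred acceptance: the applicants who are not selected are rejected by the
subschool at which they stand. -/
def daRound (C : Finset Student → Finset Student → Finset (Student × SeatType))
    (pref : Student → List SeatType) (R : Finset (Student × SeatType)) :
    Finset (Student × SeatType) :=
  R ∪ ((Finset.univ.filter fun p => p.1 ∈ applicants pref R p.2) \ selection C pref R)

/-- The rejections after `n` rounds of deferred acceptance. -/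
def rejections (C : Finset Student → Finset Student → Finset (Student × SeatType))
    (pref : Student → List SeatType) (n : ℕ) : Finset (Student × SeatType) :=
  (daRound C pref)^[n] ∅

/-- The outcome of deferred acceptance with one school, which has an open and a reserved
subschool. After as many rounds as there are pairs of a student and a subschool, no further
rejection occurs, see `daRound_rejections`. -/
def deferredAcceptance (C : Finset Student → Finset Student → Finset (Student × SeatType))
    (pref : Student → List SeatType) : Finset (Student × SeatType) :=
  selection C pref (rejections C pref (Fintype.card (Student × SeatType)))

/-- Deferred acceptance has stopped after `Fintype.card (Student × SeatType)` rounds. -/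
theorem daRound_rejections (C : Finset Student → Finset Student → Finset (Student × SeatType))
    (pref : Student → List SeatType) :
    daRound C pref (rejections C pref (Fintype.card (Student × SeatType))) =
      rejections C pref (Fintype.card (Student × SeatType)) := by
  have step : ∀ n, rejections C pref (n + 1) = daRound C pref (rejections C pref n) := fun n =>
    Function.iterate_succ_apply' _ _ _
  have key : ∀ n, daRound C pref (rejections C pref n) = rejections C pref n ∨
      n ≤ (rejections C pref n).card := by
    intro n
    induction n with
    | zero => exact Or.inr (Nat.zero_le _)
    | succ n ih =>
      by_cases h : daRound C pref (rejections C pref n) = rejections C pref n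
      · left
        rw [step, h, h]
      · right
        have hlt : (rejections C pref n).card < (daRound C pref (rejections C pref n)).card :=
          Finset.card_lt_card
            (Finset.ssubset_iff_subset_ne.2 ⟨Finset.subset_union_left, fun e => h e.symm⟩)
        have hn := ih.resolve_left h
        rw [step]
        omega
  rcases key (Fintype.card (Student × SeatType)) with h | h
  · exact h
  · have hu := (Finset.card_eq_iff_eq_univ _).1 (le_antisymm (Finset.card_le_univ _) h)
    rw [hu]
    exact Finset.univ_subset_iff.1 Finset.subset_union_left

/-- The preferences of the artificial economy in which the students in `I` rank `s^o` above `s^r`,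
the students in `I'` rank `s^r` above `s^o`, and all others are absent. -/
def artificialPref (I I' : Finset Student) (i : Student) : List SeatType :=
  if i ∈ I then [.openSeat, .reservedSeat]
  else if i ∈ I' then [.reservedSeat, .openSeat]
  else []

end DeferredAcceptance

section ChoiceRules

variable {Student School MType : Type*} [Fintype Student] [DecidableEq Student]
  [Fintype MType] [DecidableEq MType]

/-- The set of students of type `m`. -/
def ofType (E : SchoolChoice Student School MType) (m : MType) : Finset Student :=
  Finset.univ.filter fun i => E.type i = m

/-- The `n` highest-ranked students of `A` at school `s` (all of `A` if it has at most `n`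
elements): those with fewer than `n` students of `A` ranked above them. -/
def topRanked (E : SchoolChoice Student School MType) (s : School) (n : ℕ)
    (A : Finset Student) : Finset Student :=
  A.filter fun i => (A.filter fun j => E.score s i < E.score s j).card < n

/-- The students who get a reserved seat under SimFlex when `I'` is the set of applicants to
`s^r`: for each type `m`, the highest-ranked ones of type `m` up to the quota `q_s^m`. -/
def simFlexReserved (E : SchoolChoice Student School MType) (s : School) (I' : Finset Student) :
    Finset Student :=
  Finset.univ.biUnion fun m => E.topRanked s (E.reserve s m) (I' ∩ E.ofType m)

/-- The SimFlex choice rule, for the applicants `I` to `s^o` and the applicants `I'` to `s^r`: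
reserved seats are assigned first, and all remaining seats of the school are assigned as open seats
to the highest-ranked students in `I`. -/
def simFlex (E : SchoolChoice Student School MType) (s : School) (I I' : Finset Student) :
    Finset (Student × SeatType) :=
  (E.topRanked s (E.capacity s - (E.simFlexReserved s I').card) I ×ˢ {SeatType.openSeat}) ∪
    (E.simFlexReserved s I' ×ˢ {SeatType.reservedSeat})

/-- The choice rule `C*` of school `s`: the outcome of deferred acceptance in the artificial economy
of `s` and the students in `I ∪ I'`, where `s` uses the SimFlex choice rule. -/
def cStar (E : SchoolChoice Student School MType) (s : School) (I I' : Finset Student) :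
    Finset (Student × SeatType) :=
  deferredAcceptance (E.simFlex s) (artificialPref I I')

end ChoiceRules

end SchoolChoice

/-!
Suppose that the open seats go to the scores of at least `c`. Then the students with these scores
are chosen, and so is everybody who gets a reserved seat among `I'` and the rest of `I`. Within each
type `m` these are the highest-ranked students up to the quota `a + max q b`, where `q` is the
reserve quota of `m`, and `a` and `b` count the students of type `m` in `I` and in `I'` with scores
of at least `c`.

Deferred acceptance never rejects a student from a seat that she gets at a cutoff whose choice fits
into the capacity. Lowering the cutoff by one raises only the quota of the type of the student with
that score, by at most one. So at the lowest feasible cutoff either all seats are taken or everybody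
is chosen, and the outcome of `C*` is the choice at this cutoff.

When students of type `τ` switch, the quota of `τ` weakly rises at every cutoff and no other quota
changes, so the lowest feasible cutoff `c` weakly rises, to `c'` say. If `c < c'`, then the capacity
is exceeded at `c' - 1`, so some type has a larger quota there than it had at `c` before the switch,
and this type can only be `τ`. The step from `c' - 1` to `c'` then costs `τ` at most one seat.
-/

namespace SchoolChoice

open Finset

section Switch

variable {α : Type*} [DecidableEq α] {I I' A : Finset α}

theorem disjoint_union_sdiff (hd : Disjoint I I') : Disjoint (I ∪ A) (I' \ A) :=
  disjoint_union_left.2 ⟨hd.mono_right sdiff_subset, disjoint_sdiff⟩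

theorem union_union_sdiff_of_subset (I : Finset α) (hA : A ⊆ I') :
    (I ∪ A) ∪ (I' \ A) = I ∪ I' := by
  rw [union_assoc, union_sdiff_of_subset hA]

end Switch

section TypeQuotas

variable {Student School MType : Type*} [Fintype Student] [Fintype MType] [DecidableEq MType]
  {E : SchoolChoice Student School MType} {s : School} {n n' : MType → ℕ} {j : Student}

theorem mem_topRanked {q : ℕ} {A : Finset Student} :
    j ∈ E.topRanked s q A ↔ j ∈ A ∧ #{k ∈ A | E.score s j < E.score s k} < q :=
  mem_filter

theorem mem_ofType {m : MType} : j ∈ E.ofType m ↔ E.type j = m := by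
  simp [ofType]

theorem card_topRanked (q : ℕ) (A : Finset Student) : #(E.topRanked s q A) = min q #A := by
  let rank : Student → ℕ := fun j => #{k ∈ A | E.score s j < E.score s k}
  have rank_lt_rank {j k : Student} (hk : k ∈ A) (h : E.score s j < E.score s k) :
      rank k < rank j := by
    refine card_lt_card ⟨monotone_filter_right _ fun l _ => h.trans, fun hsub => ?_⟩
    simpa using hsub (mem_filter.2 ⟨hk, h⟩)
  have rank_injOn : Set.InjOn rank A := fun j hj k hk hjk => by
    rcases lt_trichotomy (E.score s j) (E.score s k) with h | h | h
    · exact absurd hjk (rank_lt_rank hk h).ne'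
    · exact E.score_injective s h
    · exact absurd hjk (rank_lt_rank hj h).ne
  have image_rank : A.image rank = range #A := by
    refine eq_of_subset_of_card_le (image_subset_iff.2 fun j hj => mem_range.2 ?_) ?_
    · exact card_lt_card (filter_ssubset.2 ⟨j, hj, lt_irrefl _⟩)
    · rw [card_image_of_injOn rank_injOn, card_range]
  calc #(E.topRanked s q A) = #((A.filter (rank · < q)).image rank) :=
        (card_image_of_injOn (rank_injOn.mono (coe_subset.2 (filter_subset _ _)))).symm
    _ = #((range #A).filter (· < q)) := by rw [← image_rank, filter_image]
    _ = #(range (min q #A)) := by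
        congr 1
        ext l
        simp [and_comm]
    _ = min q #A := card_range _

theorem card_filter_le_score_eq_add (A : Finset Student) (c : ℕ) :
    #{j ∈ A | c ≤ E.score s j} =
      #{j ∈ A | c + 1 ≤ E.score s j} + #{j ∈ A | E.score s j = c} := by
  classical
  rw [← card_union_of_disjoint, ← filter_or]
  · congr! 2 with j
    omega
  · exact disjoint_filter.2 fun j _ h => by omega

theorem card_filter_score_eq_le_one (c : ℕ) : #{j | E.score s j = c} ≤ 1 :=
  card_le_one.2 fun _ hj _ hk => E.score_injective s
    ((mem_filter.1 hj).2.trans (mem_filter.1 hk).2.symm)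

variable [DecidableEq Student] {A B : Finset Student}

/-- The choice by type quotas: of every type `m`, the `n m` highest-ranked students of `A`. With the
reserve quotas this is `simFlexReserved`; with the quotas `cutoffQuota` it describes the outcome of
deferred acceptance. -/
def quotaChoice (E : SchoolChoice Student School MType) (s : School) (n : MType → ℕ)
    (A : Finset Student) : Finset Student :=
  univ.biUnion fun m => E.topRanked s (n m) (A ∩ E.ofType m)

theorem simFlexReserved_eq_quotaChoice :
    E.simFlexReserved s A = E.quotaChoice s (E.reserve s) A :=
  rfl

theorem mem_quotaChoice :
    j ∈ E.quotaChoice s n A ↔ j ∈ A ∧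
      #{k ∈ A ∩ E.ofType (E.type j) | E.score s j < E.score s k} < n (E.type j) := by
  simp only [quotaChoice, mem_biUnion, mem_univ, true_and, mem_topRanked, mem_inter, mem_ofType]
  constructor
  · rintro ⟨_, ⟨hj, rfl⟩, h⟩
    exact ⟨hj, h⟩
  · rintro ⟨hj, h⟩
    exact ⟨_, ⟨hj, rfl⟩, h⟩

theorem quotaChoice_subset : E.quotaChoice s n A ⊆ A :=
  fun _ hj => (mem_quotaChoice.1 hj).1

theorem mem_quotaChoice_of_le (h : n (E.type j) ≤ n' (E.type j))
    (hj : j ∈ E.quotaChoice s n A) : j ∈ E.quotaChoice s n' A :=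
  mem_quotaChoice.2 ⟨(mem_quotaChoice.1 hj).1, (mem_quotaChoice.1 hj).2.trans_le h⟩

theorem mem_quotaChoice_of_subset (h : A ⊆ B) (hj : j ∈ A) (hjB : j ∈ E.quotaChoice s n B) :
    j ∈ E.quotaChoice s n A := by
  refine mem_quotaChoice.2 ⟨hj, lt_of_le_of_lt (card_le_card ?_) (mem_quotaChoice.1 hjB).2⟩
  exact filter_subset_filter _ (inter_subset_inter_right h)

theorem card_quotaChoice (n : MType → ℕ) (A : Finset Student) :
    #(E.quotaChoice s n A) = ∑ m, min (n m) #(A ∩ E.ofType m) := by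
  simp only [← card_topRanked (E := E) (s := s)]
  refine card_biUnion fun m _ m' _ hne => disjoint_left.2 fun j hj hj' => hne ?_
  have type_eq {m : MType} (h : j ∈ E.topRanked s (n m) (A ∩ E.ofType m)) : E.type j = m :=
    mem_ofType.1 (mem_inter.1 (mem_topRanked.1 h).1).2
  exact (type_eq hj).symm.trans (type_eq hj')

theorem card_quotaChoice_le_of_subset (n : MType → ℕ) (h : A ⊆ B) :
    #(E.quotaChoice s n A) ≤ #(E.quotaChoice s n B) := by
  simp only [card_quotaChoice]
  gcongr

theorem card_quotaChoice_le_of_le (h : n ≤ n') (A : Finset Student) :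
    #(E.quotaChoice s n A) ≤ #(E.quotaChoice s n' A) := by
  simp only [card_quotaChoice]
  gcongr with m
  exact h m

theorem exists_lt_of_card_quotaChoice_lt (h : #(E.quotaChoice s n A) < #(E.quotaChoice s n' A)) :
    ∃ m, n m < n' m := by
  contrapose! h
  exact card_quotaChoice_le_of_le h A

theorem card_quotaChoice_le_add (h : ∀ m, n m ≤ n' m + #(B ∩ E.ofType m)) (A : Finset Student) :
    #(E.quotaChoice s n A) ≤ #(E.quotaChoice s n' A) + #B := by
  have card_eq_sum : #B = ∑ m, #(B ∩ E.ofType m) := by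
    rw [card_eq_sum_card_fiberwise (f := E.type) (t := univ) (by simp)]
    refine sum_congr rfl fun m _ => congrArg card ?_
    ext j
    simp [mem_ofType]
  rw [card_quotaChoice, card_quotaChoice, card_eq_sum, ← sum_add_distrib]
  refine sum_le_sum fun m _ => ?_
  have := h m
  omega

theorem card_simFlexReserved_lt_capacity (A : Finset Student) :
    #(E.simFlexReserved s A) < E.capacity s := by
  rw [simFlexReserved_eq_quotaChoice, card_quotaChoice]
  exact (sum_le_sum fun m _ => min_le_left _ _).trans_lt (E.sum_reserve_lt s)

theorem mem_simFlex_openSeat {J J' : Finset Student} :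
    (j, SeatType.openSeat) ∈ E.simFlex s J J' ↔
      j ∈ E.topRanked s (E.capacity s - #(E.simFlexReserved s J')) J := by
  simp [simFlex]

theorem mem_simFlex_reservedSeat {J J' : Finset Student} :
    (j, SeatType.reservedSeat) ∈ E.simFlex s J J' ↔ j ∈ E.simFlexReserved s J' := by
  simp [simFlex]

theorem chosen_simFlex (J J' : Finset Student) :
    chosen (E.simFlex s J J') =
      E.topRanked s (E.capacity s - #(E.simFlexReserved s J')) J ∪ E.simFlexReserved s J' := by
  rw [chosen, simFlex, image_union, product_image_fst (singleton_nonempty _),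
    product_image_fst (singleton_nonempty _)]

theorem chosen_simFlex_subset (J J' : Finset Student) : chosen (E.simFlex s J J') ⊆ J ∪ J' := by
  rw [chosen_simFlex]
  exact union_subset_union (filter_subset _ _) quotaChoice_subset

theorem card_chosen_simFlex_le (J J' : Finset Student) :
    #(chosen (E.simFlex s J J')) ≤ E.capacity s := by
  have card_union := card_union_le
    (E.topRanked s (E.capacity s - #(E.simFlexReserved s J')) J) (E.simFlexReserved s J')
  have card_open := card_topRanked (E := E) (s := s) (E.capacity s - #(E.simFlexReserved s J')) J
  have card_reserved := card_simFlexReserved_lt_capacity (E := E) (s := s) J'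
  rw [chosen_simFlex]
  omega

end TypeQuotas

section DeferredAcceptance

variable {Student : Type*} [Fintype Student] [DecidableEq Student]
  {C : Finset Student → Finset Student → Finset (Student × SeatType)}
  {pref : Student → List SeatType} {R : Finset (Student × SeatType)} {j : Student}

theorem exists_mem_applicants {t : SeatType} (ht : t ∈ pref j) (hR : (j, t) ∉ R) :
    ∃ u, j ∈ applicants pref R u ∧ (j, u) ∉ R := by
  obtain ⟨u, hu⟩ : ∃ u, (pref j).find? (fun u => decide ((j, u) ∉ R)) = some u :=
    Option.isSome_iff_exists.1 (List.find?_isSome.2 ⟨t, ht, decide_eq_true hR⟩)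
  exact ⟨u, mem_filter.2 ⟨mem_univ _, hu⟩, by simpa using List.find?_some hu⟩

theorem mem_daRound {p : Student × SeatType} :
    p ∈ daRound C pref R ↔ p ∈ R ∨ p.1 ∈ applicants pref R p.2 ∧ p ∉ selection C pref R := by
  simp [daRound]

theorem mem_chosen_deferredAcceptance {t : SeatType} (ht : t ∈ pref j)
    (hR : (j, t) ∉ rejections C pref (Fintype.card (Student × SeatType))) :
    j ∈ chosen (deferredAcceptance C pref) := by
  obtain ⟨u, hu, huR⟩ := exists_mem_applicants ht hR
  rw [← daRound_rejections, mem_daRound] at huR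
  exact mem_image_of_mem Prod.fst (by_contra fun hsel => huR (Or.inr ⟨hu, hsel⟩))

variable {I I' : Finset Student}

theorem mem_of_mem_applicants_openSeat
    (hj : j ∈ applicants (artificialPref I I') R .openSeat) :
    j ∈ I ∨ j ∈ I' ∧ (j, SeatType.reservedSeat) ∈ R := by
  by_cases hI : j ∈ I <;> by_cases hI' : j ∈ I' <;>
    grind [applicants, artificialPref]

theorem mem_of_mem_applicants_reservedSeat
    (hj : j ∈ applicants (artificialPref I I') R .reservedSeat) :
    j ∈ I' ∨ j ∈ I ∧ (j, SeatType.openSeat) ∈ R := by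
  by_cases hI : j ∈ I <;> by_cases hI' : j ∈ I' <;>
    grind [applicants, artificialPref]

end DeferredAcceptance

section Cutoff

variable {Student School MType : Type*} [Fintype Student] [DecidableEq Student]
  [Fintype MType] [DecidableEq MType] {E : SchoolChoice Student School MType} {s : School}
  {I I' A : Finset Student} {c : ℕ} {j : Student} {m : MType}

/-- The students who apply for a reserved seat when the open seats go to scores of at least `c`. -/
def reservedDemand (E : SchoolChoice Student School MType) (s : School) (I I' : Finset Student)
    (c : ℕ) : Finset Student :=
  I' ∪ {j ∈ I | E.score s j < c}

/-- The students who get a seat when the open seats go to scores of at least `c`, whether or not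
the capacity suffices. -/
def cutoffChoice (E : SchoolChoice Student School MType) (s : School) (I I' : Finset Student)
    (c : ℕ) : Finset Student :=
  {j ∈ I ∪ I' | c ≤ E.score s j} ∪ E.simFlexReserved s (E.reservedDemand s I I' c)

/-- The number of seats to which type `m` is entitled when the open seats go to scores of at least
`c`: an open one for each student of `I` above the cutoff, and the reserved ones or, if these are
fewer, one for each student of `I'` above the cutoff. It may exceed the number of students of
type `m`. -/
def cutoffQuota (E : SchoolChoice Student School MType) (s : School) (I I' : Finset Student)
    (c : ℕ) (m : MType) : ℕ :=
  #{j ∈ I ∩ E.ofType m | c ≤ E.score s j} +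
    max (E.reserve s m) #{j ∈ I' ∩ E.ofType m | c ≤ E.score s j}

/-- The lowest cutoff for the open seats at which the capacity suffices. -/
noncomputable def cutoff (E : SchoolChoice Student School MType) (s : School)
    (I I' : Finset Student) : ℕ :=
  sInf {c | #(E.cutoffChoice s I I' c) ≤ E.capacity s}

theorem mem_reservedDemand :
    j ∈ E.reservedDemand s I I' c ↔ j ∈ I' ∨ j ∈ I ∧ E.score s j < c := by
  simp [reservedDemand]

theorem mem_cutoffChoice :
    j ∈ E.cutoffChoice s I I' c ↔ (j ∈ I ∨ j ∈ I') ∧ c ≤ E.score s j ∨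
      j ∈ E.simFlexReserved s (E.reservedDemand s I I' c) := by
  simp [cutoffChoice]

theorem card_filter_union_inter_ofType (hd : Disjoint I I') (p : Student → Prop)
    [DecidablePred p] :
    #{k ∈ (I ∪ I') ∩ E.ofType m | p k} =
      #{k ∈ I ∩ E.ofType m | p k} + #{k ∈ I' ∩ E.ofType m | p k} := by
  rw [union_inter_distrib_right, filter_union, card_union_of_disjoint]
  exact disjoint_filter_filter (hd.mono inter_subset_left inter_subset_left)

theorem card_above_eq_add_of_score_lt (hd : Disjoint I I') (hj : E.score s j < c) :
    #{k ∈ (I ∪ I') ∩ E.ofType m | E.score s j < E.score s k} =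
      #{k ∈ I ∩ E.ofType m | c ≤ E.score s k} +
        #{k ∈ E.reservedDemand s I I' c ∩ E.ofType m | E.score s j < E.score s k} := by
  rw [← card_union_of_disjoint]
  · congr 1
    ext k
    simp only [mem_filter, mem_union, mem_inter, mem_reservedDemand]
    by_cases hk : E.score s k < c
    · simp only [hk, not_le.2 hk]
      tauto
    · have := hj.trans_le (not_lt.1 hk)
      simp only [hk, not_lt.1 hk, this]
      tauto
  · refine disjoint_left.2 fun k hk hk' => ?_
    simp only [mem_filter, mem_inter, mem_reservedDemand] at hk hk'
    rcases hk'.1.1 with h | h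
    · exact disjoint_left.1 hd hk.1.1 h
    · exact h.2.not_ge hk.2

theorem cutoffChoice_eq_quotaChoice (hd : Disjoint I I') (c : ℕ) :
    E.cutoffChoice s I I' c = E.quotaChoice s (E.cutoffQuota s I I' c) (I ∪ I') := by
  ext j
  rw [mem_cutoffChoice, simFlexReserved_eq_quotaChoice, mem_quotaChoice, mem_quotaChoice,
    mem_reservedDemand, mem_union, cutoffQuota]
  rcases lt_or_ge (E.score s j) c with hlt | hge
  · have card_above := card_above_eq_add_of_score_lt (m := E.type j) hd hlt
    have card_le : #{k ∈ I' ∩ E.ofType (E.type j) | c ≤ E.score s k} ≤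
        #{k ∈ E.reservedDemand s I I' c ∩ E.ofType (E.type j) | E.score s j < E.score s k} :=
      card_le_card fun k hk => by
        simp only [mem_filter, mem_inter, mem_reservedDemand] at hk ⊢
        exact ⟨⟨Or.inl hk.1.1, hk.1.2⟩, hlt.trans_le hk.2⟩
    rw [card_above, add_lt_add_iff_left, lt_max_iff, or_iff_left card_le.not_gt]
    simp only [hlt, hlt.not_ge, and_true, and_false, false_or, or_comm]
  · have card_lt (hj : j ∈ I ∨ j ∈ I') :
        #{k ∈ (I ∪ I') ∩ E.ofType (E.type j) | E.score s j < E.score s k} <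
          #{k ∈ (I ∪ I') ∩ E.ofType (E.type j) | c ≤ E.score s k} := by
      refine card_lt_card ⟨monotone_filter_right _ fun k _ => hge.trans ∘ le_of_lt, fun hsub => ?_⟩
      have := hsub (mem_filter.2 ⟨mem_inter.2 ⟨mem_union.2 hj, mem_ofType.2 rfl⟩, hge⟩)
      exact lt_irrefl _ (mem_filter.1 this).2
    rw [card_filter_union_inter_ofType hd (c ≤ E.score s ·)] at card_lt
    have card_lt_quota (hj : j ∈ I ∨ j ∈ I') :=
      (card_lt hj).trans_le (Nat.add_le_add_left (le_max_right (E.reserve s (E.type j)) _) _)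
    refine ⟨fun h => ?_, fun h => Or.inl ⟨h.1, hge⟩⟩
    have hU : j ∈ I ∨ j ∈ I' := by tauto
    exact ⟨hU, card_lt_quota hU⟩

theorem cutoffQuota_antitone : Antitone (E.cutoffQuota s I I') := fun c d hcd m => by
  unfold cutoffQuota
  gcongr

theorem cutoffQuota_le_succ_add (hd : Disjoint I I') (c : ℕ) (m : MType) :
    E.cutoffQuota s I I' c m ≤
      E.cutoffQuota s I I' (c + 1) m +
        #(({j | E.score s j = c} : Finset Student) ∩ E.ofType m) := by
  have card_eq := card_filter_union_inter_ofType (E := E) (m := m) hd (E.score s · = c)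
  have card_le : #{j ∈ (I ∪ I') ∩ E.ofType m | E.score s j = c} ≤
      #(({j | E.score s j = c} : Finset Student) ∩ E.ofType m) :=
    card_le_card fun j hj => by
      simp only [mem_filter, mem_inter, mem_univ, true_and] at hj ⊢
      exact ⟨hj.2, hj.1.2⟩
  rw [cutoffQuota, cutoffQuota, card_filter_le_score_eq_add (c := c),
    card_filter_le_score_eq_add (c := c)]
  omega

theorem cutoffQuota_le_succ_add_one (hd : Disjoint I I') (c : ℕ) (m : MType) :
    E.cutoffQuota s I I' c m ≤ E.cutoffQuota s I I' (c + 1) m + 1 :=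
  (cutoffQuota_le_succ_add hd c m).trans <| Nat.add_le_add_left
    ((card_le_card inter_subset_left).trans (card_filter_score_eq_le_one c)) _

theorem card_cutoffChoice_le_succ_add_one (hd : Disjoint I I') (c : ℕ) :
    #(E.cutoffChoice s I I' c) ≤ #(E.cutoffChoice s I I' (c + 1)) + 1 := by
  rw [cutoffChoice_eq_quotaChoice hd, cutoffChoice_eq_quotaChoice hd]
  exact (card_quotaChoice_le_add (cutoffQuota_le_succ_add hd c) _).trans
    (Nat.add_le_add_left (card_filter_score_eq_le_one c) _)

theorem card_cutoffChoice_cutoff_le :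
    #(E.cutoffChoice s I I' (E.cutoff s I I')) ≤ E.capacity s := by
  refine Nat.sInf_mem (s := {c | #(E.cutoffChoice s I I' c) ≤ E.capacity s})
    ⟨univ.sup (E.score s) + 1, ?_⟩
  refine (card_le_card fun j hj => ?_).trans (card_simFlexReserved_lt_capacity
    (E.reservedDemand s I I' (univ.sup (E.score s) + 1))).le
  refine (mem_cutoffChoice.1 hj).resolve_left fun h => ?_
  exact (Nat.lt_of_succ_le h.2).not_ge (le_sup (f := E.score s) (mem_univ j))

theorem capacity_lt_card_cutoffChoice (h : c < E.cutoff s I I') :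
    E.capacity s < #(E.cutoffChoice s I I' c) :=
  lt_of_not_ge (Nat.notMem_of_lt_sInf (m := c) h)

/-- The invariant of deferred acceptance: no student has been rejected from a seat that she gets
when the open seats go to scores of at least `c`. -/
def RespectsCutoff (E : SchoolChoice Student School MType) (s : School) (I I' : Finset Student)
    (c : ℕ) (R : Finset (Student × SeatType)) : Prop :=
  (∀ j, (j, SeatType.openSeat) ∈ R → E.score s j < c) ∧
    ∀ j, (j, SeatType.reservedSeat) ∈ R → j ∉ E.simFlexReserved s (E.reservedDemand s I I' c)

variable {R : Finset (Student × SeatType)}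

theorem RespectsCutoff.applicants_subset_reservedDemand (hR : E.RespectsCutoff s I I' c R) :
    applicants (artificialPref I I') R .reservedSeat ⊆ E.reservedDemand s I I' c :=
  fun j hj => mem_reservedDemand.2 <|
    (mem_of_mem_applicants_reservedSeat hj).imp_right <| And.imp_right (hR.1 j)

theorem RespectsCutoff.card_applicants_add_le (hR : E.RespectsCutoff s I I' c R)
    (hd : Disjoint I I') :
    #{k ∈ applicants (artificialPref I I') R .openSeat | c ≤ E.score s k} +
      #(E.simFlexReserved s (E.reservedDemand s I I' c)) ≤ #(E.cutoffChoice s I I' c) := by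
  rw [← card_union_of_disjoint]
  · refine card_le_card (union_subset_union_left fun k hk => ?_)
    rw [mem_filter] at hk ⊢
    exact ⟨mem_union.2 ((mem_of_mem_applicants_openSeat hk.1).imp_right And.left), hk.2⟩
  · refine disjoint_left.2 fun k hk hk' => ?_
    rw [mem_filter] at hk
    rcases mem_of_mem_applicants_openSeat hk.1 with hI | ⟨-, hkR⟩
    · rcases mem_reservedDemand.1 (quotaChoice_subset hk') with hI' | ⟨-, hlt⟩
      · exact disjoint_left.1 hd hI hI'
      · exact hlt.not_ge hk.2
    · exact hR.2 k hkR hk'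

theorem RespectsCutoff.daRound (hR : E.RespectsCutoff s I I' c R) (hd : Disjoint I I')
    (hc : #(E.cutoffChoice s I I' c) ≤ E.capacity s) :
    E.RespectsCutoff s I I' c (daRound (E.simFlex s) (artificialPref I I') R) := by
  refine ⟨fun j hj => ?_, fun j hj => ?_⟩
  · rcases mem_daRound.1 hj with hj | ⟨happ, hsel⟩
    · exact hR.1 j hj
    by_contra! hge
    refine hsel (mem_simFlex_openSeat.2 (mem_topRanked.2 ⟨happ, ?_⟩))
    have card_above_lt : #{k ∈ applicants (artificialPref I I') R .openSeat |
          E.score s j < E.score s k} <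
        #{k ∈ applicants (artificialPref I I') R .openSeat | c ≤ E.score s k} := by
      refine card_lt_card ⟨monotone_filter_right _ fun k _ => hge.trans ∘ le_of_lt, fun hsub => ?_⟩
      simpa using hsub (mem_filter.2 ⟨happ, hge⟩)
    have card_reserved_le :
        #(E.simFlexReserved s (applicants (artificialPref I I') R .reservedSeat)) ≤
          #(E.simFlexReserved s (E.reservedDemand s I I' c)) :=
      card_quotaChoice_le_of_subset _ hR.applicants_subset_reservedDemand
    have := hR.card_applicants_add_le hd
    omega
  · rcases mem_daRound.1 hj with hj | ⟨happ, hsel⟩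
    · exact hR.2 j hj
    · exact fun hres => hsel <| mem_simFlex_reservedSeat.2 <|
        mem_quotaChoice_of_subset hR.applicants_subset_reservedDemand happ hres

theorem respectsCutoff_rejections (hd : Disjoint I I')
    (hc : #(E.cutoffChoice s I I' c) ≤ E.capacity s) (n : ℕ) :
    E.RespectsCutoff s I I' c (rejections (E.simFlex s) (artificialPref I I') n) := by
  refine Function.Iterate.rec (E.RespectsCutoff s I I' c) ?_ (fun R hR => hR.daRound hd hc) n
  exact ⟨by simp, by simp⟩

theorem cutoffChoice_subset_chosen_cStar (hd : Disjoint I I')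
    (hc : #(E.cutoffChoice s I I' c) ≤ E.capacity s) :
    E.cutoffChoice s I I' c ⊆ chosen (E.cStar s I I') := by
  intro j hj
  obtain ⟨hopen, hreserved⟩ :=
    respectsCutoff_rejections hd hc (Fintype.card (Student × SeatType))
  have mem_pref (t : SeatType) (h : j ∈ I ∨ j ∈ I') : t ∈ artificialPref I I' j := by
    cases t <;> grind [artificialPref]
  rcases mem_cutoffChoice.1 hj with ⟨hU, hge⟩ | hres
  · exact mem_chosen_deferredAcceptance (mem_pref .openSeat hU) fun h => (hopen j h).not_ge hge
  · have hU : j ∈ I ∨ j ∈ I' :=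
      (mem_reservedDemand.1 (quotaChoice_subset hres)).symm.imp_left And.left
    exact mem_chosen_deferredAcceptance (mem_pref .reservedSeat hU) fun h => hreserved j h hres

theorem chosen_cStar_subset : chosen (E.cStar s I I') ⊆ I ∪ I' := by
  refine (chosen_simFlex_subset _ _).trans (union_subset (fun j hj => ?_) fun j hj => ?_)
  · exact mem_union.2 ((mem_of_mem_applicants_openSeat hj).imp_right And.left)
  · exact mem_union.2 ((mem_of_mem_applicants_reservedSeat hj).imp_right And.left).symm

theorem chosen_cStar_eq_cutoffChoice (hd : Disjoint I I') :
    chosen (E.cStar s I I') = E.cutoffChoice s I I' (E.cutoff s I I') := by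
  have hsub := cutoffChoice_subset_chosen_cStar hd (card_cutoffChoice_cutoff_le (E := E) (s := s))
  refine (hsub.antisymm ?_).symm
  rcases hcut : E.cutoff s I I' with _ | d
  · exact fun j hj => mem_cutoffChoice.2
      (Or.inl ⟨mem_union.1 (chosen_cStar_subset hj), Nat.zero_le _⟩)
  · rw [hcut] at hsub
    have capacity_lt : E.capacity s < #(E.cutoffChoice s I I' d) :=
      capacity_lt_card_cutoffChoice (by omega)
    have card_le : #(chosen (E.cStar s I I')) ≤ E.capacity s := card_chosen_simFlex_le _ _
    have card_le_succ := card_cutoffChoice_le_succ_add_one (E := E) (s := s) hd d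
    exact (eq_of_subset_of_card_le hsub (by omega)).symm.subset

theorem cutoffQuota_le_switch (hd : Disjoint I I') (hA : A ⊆ I') (c : ℕ) (m : MType) :
    E.cutoffQuota s I I' c m ≤ E.cutoffQuota s (I ∪ A) (I' \ A) c m := by
  have card_left := card_filter_union_inter_ofType (E := E) (m := m) (hd.mono_right hA)
    (c ≤ E.score s ·)
  have card_right := card_filter_union_inter_ofType (E := E) (m := m)
    (disjoint_sdiff_self_left (x := A) (y := I')) (c ≤ E.score s ·)
  rw [sdiff_union_of_subset hA] at card_right
  rw [cutoffQuota, cutoffQuota]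
  omega

theorem cutoffQuota_switch_of_ne (hA : A ⊆ E.ofType m) {m' : MType} (hne : m' ≠ m) (c : ℕ) :
    E.cutoffQuota s (I ∪ A) (I' \ A) c m' = E.cutoffQuota s I I' c m' := by
  have hdA : Disjoint A (E.ofType m') := disjoint_left.2 fun j hj hj' =>
    hne ((mem_ofType.1 hj').symm.trans (mem_ofType.1 (hA hj)))
  have hI : (I ∪ A) ∩ E.ofType m' = I ∩ E.ofType m' := by
    rw [union_inter_distrib_right, disjoint_iff_inter_eq_empty.1 hdA, union_empty]
  have hI' : (I' \ A) ∩ E.ofType m' = I' ∩ E.ofType m' := by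
    rw [sdiff_inter_right_comm, sdiff_eq_self_of_disjoint (hdA.symm.mono_left inter_subset_right)]
  rw [cutoffQuota, cutoffQuota, hI, hI']

theorem cutoff_le_cutoff_switch (hd : Disjoint I I') (hA : A ⊆ I') :
    E.cutoff s I I' ≤ E.cutoff s (I ∪ A) (I' \ A) := by
  refine Nat.sInf_le (le_trans ?_ (card_cutoffChoice_cutoff_le (I := I ∪ A) (I' := I' \ A)))
  rw [cutoffChoice_eq_quotaChoice hd, cutoffChoice_eq_quotaChoice (disjoint_union_sdiff hd),
    union_union_sdiff_of_subset I hA]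
  exact card_quotaChoice_le_of_le (cutoffQuota_le_switch hd hA _) _

theorem cutoffQuota_cutoff_le_switch (hd : Disjoint I I') (hA : A ⊆ I' ∩ E.ofType m) :
    E.cutoffQuota s I I' (E.cutoff s I I') m ≤
      E.cutoffQuota s (I ∪ A) (I' \ A) (E.cutoff s (I ∪ A) (I' \ A)) m := by
  obtain ⟨hAI', hAm⟩ := subset_inter_iff.1 hA
  rcases (cutoff_le_cutoff_switch (E := E) (s := s) hd hAI').eq_or_lt with heq | hlt
  · rw [← heq]
    exact cutoffQuota_le_switch hd hAI' _ m
  obtain ⟨d, hcut⟩ := Nat.exists_eq_add_one_of_ne_zero (Nat.ne_zero_of_lt hlt)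
  have card_lt : #(E.cutoffChoice s I I' (E.cutoff s I I')) <
      #(E.cutoffChoice s (I ∪ A) (I' \ A) d) :=
    card_cutoffChoice_cutoff_le.trans_lt (capacity_lt_card_cutoffChoice (by omega))
  rw [cutoffChoice_eq_quotaChoice hd, cutoffChoice_eq_quotaChoice (disjoint_union_sdiff hd),
    union_union_sdiff_of_subset I hAI'] at card_lt
  obtain ⟨m', hm'⟩ := exists_lt_of_card_quotaChoice_lt card_lt
  obtain rfl : m' = m := by
    by_contra hne
    rw [cutoffQuota_switch_of_ne hAm hne] at hm'
    exact hm'.not_ge (cutoffQuota_antitone (by omega) m')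
  rw [hcut]
  exact Nat.le_of_lt_succ <|
    hm'.trans_le (cutoffQuota_le_succ_add_one (disjoint_union_sdiff hd) d m')

end Cutoff

end SchoolChoice

theorem mainTheorem8_general {Student School MType : Type*} [Fintype Student]
    [DecidableEq Student] [Fintype MType] [DecidableEq MType]
    (E : SchoolChoice Student School MType) (s : School) {I I' A : Finset Student}
    (hdisj : Disjoint I I') {m : MType} (hA : A ⊆ I' ∩ E.ofType m) :
    SchoolChoice.chosen (E.cStar s I I') ∩ E.ofType m ⊆
      SchoolChoice.chosen (E.cStar s (I ∪ A) (I' \ A)) ∩ E.ofType m := by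
  have hdisj' : Disjoint (I ∪ A) (I' \ A) := SchoolChoice.disjoint_union_sdiff hdisj
  have hunion : (I ∪ A) ∪ (I' \ A) = I ∪ I' :=
    SchoolChoice.union_union_sdiff_of_subset I (Finset.subset_inter_iff.1 hA).1
  rw [SchoolChoice.chosen_cStar_eq_cutoffChoice hdisj,
    SchoolChoice.chosen_cStar_eq_cutoffChoice hdisj',
    SchoolChoice.cutoffChoice_eq_quotaChoice hdisj,
    SchoolChoice.cutoffChoice_eq_quotaChoice hdisj', hunion]
  intro j hj
  obtain ⟨hchosen, htype⟩ := Finset.mem_inter.1 hj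
  obtain rfl : E.type j = m := SchoolChoice.mem_ofType.1 htype
  exact Finset.mem_inter.2 ⟨SchoolChoice.mem_quotaChoice_of_le
    (SchoolChoice.cutoffQuota_cutoff_le_switch hdisj hA) hchosen, htype⟩

theorem mainTheorem8 {Student School MType : Type*} [Fintype Student] [DecidableEq Student]
    [Fintype MType] [DecidableEq MType] (E : SchoolChoice Student School MType) (s : School)
    (I I' : Finset Student) (hdisj : Disjoint I I') (i : Student) (hi : i ∈ I') :
    SchoolChoice.chosen (E.cStar s I I') ∩ E.ofType (E.type i) ⊆
      SchoolChoice.chosen (E.cStar s (I ∪ {i}) (I' \ {i})) ∩ E.ofType (E.type i) :=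
  mainTheorem8_general E s hdisj <| Finset.singleton_subset_iff.2 <|
    Finset.mem_inter.2 ⟨hi, SchoolChoice.mem_ofType.2 rfl⟩
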